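/- Let $G$ be a finitely generated group and let $S$ be a finite generating set of $G$ with $e\notin S$ and $S=S^{-1}$. Let $d_S$ be the word metric on $G$: $d_S(x,y)$ is the least $n\ge 0$ such that $x^{-1}y=s_1\cdots s_n$ with all $s_i\in S$. Let $\delta\ge 0$ be a real number and suppose that $G$ is $\delta$-hyperbolic with respect to $S$, i.e. for all $x,y,z,t\in G$ $$d_S(x,y)+d_S(z,t)\le \max\{d_S(x,z)+d_S(y,t),\; d_S(x,t)+d_S(y,z)\}+2\delta .$$ Let $d\in\mathbb{N}$ with $d\ge 32\delta+20$, and let $P_d(G)=P_d(G,S)$ be the Rips complex, that is, (the geometric realization, with the weak topology, of) the simplicial complex with vertex set $G$ whose $k$-simplices are the sets of $k+1$ distinct elements $g_0,\dots,g_k$ of $G$ with $\max_{i,j}d_S(g_i,g_j)\le d$. The group $G$ acts on $P_d(G)$ simplicially by left multiplication on the vertices. Then for every finite subgroup $H$ of $G$, the fixed point set $P_d(G)^H=\{p\in P_d(G) : hp=p \text{ for all } h\in H\}$ (with the subspace topology) is contractible. -/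

import Mathlib

open scoped Pointwise

section WordMetric

variable {G : Type*} [Group G]

/-- The word metric on `G` with respect to `S`: the distance from `x` to `y` is the least length
`n` of an expression `x⁻¹ * y = s₁ * ⋯ * sₙ` with all `sᵢ ∈ S`. (Such an expression exists
whenever `S` is a symmetric generating set.) -/
noncomputable def wordDist (S : Set G) (x y : G) : ℕ :=
  sInf {n | ∃ l : List G, (∀ s ∈ l, s ∈ S) ∧ l.length = n ∧ l.prod = x⁻¹ * y}

theorem wordDist_self (S : Set G) (x : G) : wordDist S x x = 0 :=
  Nat.sInf_eq_zero.2 (Or.inl ⟨[], by simp⟩)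

theorem wordDist_mul_left (S : Set G) (g x y : G) :
    wordDist S (g * x) (g * y) = wordDist S x y := by
  simp [wordDist, mul_assoc]

/-- The four-point condition: the distance function `dist` on `X` is `δ`-hyperbolic. -/
def IsHyperbolicDist {X : Type*} (dist : X → X → ℝ) (δ : ℝ) : Prop :=
  0 ≤ δ ∧ ∀ x y z t : X,
    dist x y + dist z t ≤ max (dist x z + dist y t) (dist x t + dist y z) + 2 * δ

/-- The group `G` with its word metric relative to `S` is `δ`-hyperbolic. -/
def IsHyperbolicGroup (S : Set G) (δ : ℝ) : Prop :=
  IsHyperbolicDist (fun x y : G => (wordDist S x y : ℝ)) δ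

end WordMetric

section Realization

variable {V : Type*}

/-- The points of the geometric realization of an abstract simplicial complex `K`, in barycentric
coordinates: nonnegative weights on the vertices, with sum `1`, whose support is a simplex. -/
@[ext]
structure SimplicialRealization (K : AbstractSimplicialComplex V) where
  weight : V →₀ ℝ
  nonneg : ∀ v, 0 ≤ weight v
  sum_eq_one : (weight.sum fun _ a => a) = 1
  support_mem : weight.support ∈ K.faces

namespace SimplicialRealization

variable {K : AbstractSimplicialComplex V}

theorem simplexMap_aux {σ : Finset V} (hσ : σ ∈ K.faces) (p : stdSimplex ℝ σ) :
    (Finsupp.embDomain (Function.Embedding.subtype (· ∈ σ))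
      (Finsupp.equivFunOnFinite.symm p.1)).support ∈ K.faces := by
  refine (K.isRelLowerSet_faces hσ).2 ?_ ?_
  · intro v hv
    rw [Finsupp.support_embDomain, Finset.mem_map] at hv
    obtain ⟨a, -, rfl⟩ := hv
    exact a.2
  · rw [Finsupp.support_embDomain, Finset.map_nonempty, Finsupp.support_nonempty_iff]
    intro h
    have h0 : p.1 = 0 := funext fun a => DFunLike.congr_fun h a
    have h1 := p.2.2
    simp [h0] at h1

/-- The inclusion of the closed simplex spanned by `σ`, modelled on the standard simplex with
vertex set `σ`; the coordinates at vertices outside `σ` are `0`. -/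
noncomputable def simplexMap {σ : Finset V} (hσ : σ ∈ K.faces) (p : stdSimplex ℝ σ) :
    SimplicialRealization K where
  weight := Finsupp.embDomain (Function.Embedding.subtype (· ∈ σ))
    (Finsupp.equivFunOnFinite.symm p.1)
  nonneg v := by
    by_cases hv : v ∈ σ
    · have := Finsupp.embDomain_apply_self (Function.Embedding.subtype (· ∈ σ))
        (Finsupp.equivFunOnFinite.symm p.1) ⟨v, hv⟩
      rw [Function.Embedding.subtype_apply] at this
      rw [this]
      exact p.2.1 _
    · rw [Finsupp.embDomain_of_notMem_range]
      simpa using hv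
  sum_eq_one := by
    rw [Finsupp.sum_embDomain, Finsupp.sum_fintype _ _ (fun _ => rfl)]
    exact p.2.2
  support_mem := simplexMap_aux hσ p

/-- The weak topology: a set is open if and only if its preimage in every closed simplex is. -/
noncomputable instance instTopologicalSpaceRealization :
    TopologicalSpace (SimplicialRealization K) :=
  ⨆ σ : K.faces, TopologicalSpace.coinduced (simplexMap σ.2) inferInstance

end SimplicialRealization

end Realization

section Rips

variable {G : Type*} [Group G]

/-- The Rips complex `P_d(G, S)`: its vertices are the elements of `G`, and its simplices are the
nonempty finite subsets of `G` of diameter at most `d` in the word metric. -/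
def ripsComplex (S : Set G) (d : ℕ) : AbstractSimplicialComplex G where
  faces := {σ | σ.Nonempty ∧ ∀ x ∈ σ, ∀ y ∈ σ, wordDist S x y ≤ d}
  isRelLowerSet_faces := fun _ hσ =>
    ⟨hσ.1, fun _ hτσ hτ => ⟨hτ, fun x hx y hy => hσ.2 x (hτσ hx) y (hτσ hy)⟩⟩
  singleton_mem v := by simp [wordDist_self]

/-- The simplicial action of `G` on the Rips complex, `g • {g₀, …, gₖ} = {g g₀, …, g gₖ}`,
extended affinely over the simplices. -/
noncomputable instance ripsMulAction (S : Set G) (d : ℕ) :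
    MulAction G (SimplicialRealization (ripsComplex S d)) where
  smul g p :=
    { weight := p.weight.mapDomain (g * ·)
      nonneg := fun v => by
        have := Finsupp.mapDomain_apply (mul_right_injective g) p.weight (g⁻¹ * v)
        simp only [mul_inv_cancel_left] at this
        rw [this]
        exact p.nonneg _
      sum_eq_one := by
        rw [Finsupp.sum_mapDomain_index (fun _ => rfl) (fun _ _ _ => rfl)]
        exact p.sum_eq_one
      support_mem := by
        classical
        rw [Finsupp.mapDomain_support_of_injective (mul_right_injective g)]
        obtain ⟨h1, h2⟩ := p.support_mem
        refine ⟨h1.image _, ?_⟩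
        simp only [Finset.forall_mem_image, wordDist_mul_left]
        exact h2 }
  one_smul p := by
    apply SimplicialRealization.ext
    change p.weight.mapDomain (1 * ·) = p.weight
    simp only [one_mul]
    exact Finsupp.mapDomain_id
  mul_smul g h p := by
    apply SimplicialRealization.ext
    change p.weight.mapDomain (g * h * ·) =
      (p.weight.mapDomain (h * ·)).mapDomain (g * ·)
    rw [← Finsupp.mapDomain_comp]
    simp only [Function.comp_def, mul_assoc]

end Rips

/-! ### Geometry of the word metric -/

section WordMetricLemmas

variable {G : Type*} [Group G] {S : Set G}

/-! A fixed point of `H` is an `H`-invariant probability measure whose support is a simplex. Such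
measures are contracted onto the uniform measure of one orbit `H x₀` of small diameter, which exists
by hyperbolicity (`exists_orbit_wordDist_le`).

Let the level of `x` be its distance to `H x₀`, and let `f` move `x` a bounded distance along a
geodesic to a nearest point of that orbit. By the four-point condition, `f x` stays within `d` of
every neighbour of `x` of no greater level (`exists_level_push`). Pushing mass along `f`, higher
levels first and in disjoint time intervals, therefore keeps supports inside simplices
(`exists_adj_of_mem_support_pushFlow`).

The map `f` need not be `H`-equivariant: every vertex is replaced by its orbit average, so all
measures stay invariant, and at time 0 an invariant measure is unchanged
(`linearCombination_orbitAverage`). There are infinitely many levels, but each vertex is at rest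
near time 0. Local finiteness reduces continuity to that of single coordinates
(`isInducing_weight`). -/

theorem wordDist_le_length {x y : G} (l : List G) (hl : ∀ s ∈ l, s ∈ S)
    (hp : l.prod = x⁻¹ * y) : wordDist S x y ≤ l.length :=
  Nat.sInf_le ⟨l, hl, rfl, hp⟩

theorem exists_word_length_eq_wordDist (hgen : Subgroup.closure S = ⊤) (hsymm : S⁻¹ = S)
    (x y : G) :
    ∃ l : List G, (∀ s ∈ l, s ∈ S) ∧ l.length = wordDist S x y ∧ l.prod = x⁻¹ * y := by
  refine Nat.sInf_mem (s := {n | ∃ l : List G, (∀ s ∈ l, s ∈ S) ∧ l.length = n ∧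
    l.prod = x⁻¹ * y}) ?_
  have hmem : x⁻¹ * y ∈ (Subgroup.closure S).toSubmonoid := by rw [hgen]; trivial
  rw [Subgroup.closure_toSubmonoid, hsymm, Set.union_self] at hmem
  obtain ⟨l, hl, hp⟩ := Submonoid.exists_list_of_mem_closure hmem
  exact ⟨l.length, l, hl, rfl, hp⟩

theorem wordDist_triangle (hgen : Subgroup.closure S = ⊤) (hsymm : S⁻¹ = S) (x y z : G) :
    wordDist S x z ≤ wordDist S x y + wordDist S y z := by
  obtain ⟨l, hl, hn, hp⟩ := exists_word_length_eq_wordDist hgen hsymm x y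
  obtain ⟨l', hl', hn', hp'⟩ := exists_word_length_eq_wordDist hgen hsymm y z
  rw [← hn, ← hn', ← List.length_append]
  refine wordDist_le_length _ (fun s hs => ?_) ?_
  · exact (List.mem_append.1 hs).elim (hl s) (hl' s)
  · rw [List.prod_append, hp, hp']; group

theorem wordDist_comm_le (hgen : Subgroup.closure S = ⊤) (hsymm : S⁻¹ = S) (x y : G) :
    wordDist S x y ≤ wordDist S y x := by
  obtain ⟨l, hl, hn, hp⟩ := exists_word_length_eq_wordDist hgen hsymm y x
  have := wordDist_le_length (S := S) (x := x) (y := y) (l.map (·⁻¹)).reverse ?_ ?_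
  · simpa [hn] using this
  · intro s hs
    obtain ⟨a, ha, rfl⟩ : ∃ a ∈ l, a⁻¹ = s := by simpa using hs
    rw [← hsymm]; simpa using hl a ha
  · rw [← List.prod_inv_reverse, hp]; group

theorem wordDist_comm (hgen : Subgroup.closure S = ⊤) (hsymm : S⁻¹ = S) (x y : G) :
    wordDist S x y = wordDist S y x :=
  (wordDist_comm_le hgen hsymm x y).antisymm (wordDist_comm_le hgen hsymm y x)

theorem eq_of_wordDist_eq_zero (hgen : Subgroup.closure S = ⊤) (hsymm : S⁻¹ = S) {x y : G}
    (h : wordDist S x y = 0) : x = y := by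
  obtain ⟨l, -, hn, hp⟩ := exists_word_length_eq_wordDist hgen hsymm x y
  rw [h, List.length_eq_zero_iff] at hn
  subst hn
  exact inv_mul_eq_one.1 hp.symm

/-- Cut a shortest word after `k` letters; the triangle inequality forces both pieces to be
shortest. This replaces geodesics. -/
theorem exists_wordDist_eq (hgen : Subgroup.closure S = ⊤) (hsymm : S⁻¹ = S) {x y : G} {k : ℕ}
    (hk : k ≤ wordDist S x y) :
    ∃ z, wordDist S x z = k ∧ k + wordDist S z y = wordDist S x y := by
  obtain ⟨l, hl, hn, hp⟩ := exists_word_length_eq_wordDist hgen hsymm x y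
  have h1 := wordDist_le_length (S := S) (x := x) (y := x * (l.take k).prod) (l.take k)
    (fun s hs => hl s (List.mem_of_mem_take hs)) (by group)
  have h2 := wordDist_le_length (S := S) (x := x * (l.take k).prod) (y := y) (l.drop k)
    (fun s hs => hl s (List.mem_of_mem_drop hs))
    (by rw [mul_inv_rev, mul_assoc, ← hp, ← List.prod_take_mul_prod_drop l k]; group)
  have h3 := wordDist_triangle hgen hsymm x (x * (l.take k).prod) y
  rw [List.length_take] at h1
  rw [List.length_drop] at h2
  refine ⟨x * (l.take k).prod, ?_, ?_⟩ <;> omega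

theorem finite_setOf_wordDist_le (hfin : S.Finite) (hgen : Subgroup.closure S = ⊤)
    (hsymm : S⁻¹ = S) (x : G) (n : ℕ) : {y | wordDist S x y ≤ n}.Finite := by
  have : Finite S := hfin
  refine ((List.finite_length_le S n).image fun l => x * (l.map (↑)).prod).subset fun y hy => ?_
  obtain ⟨l, hl, hn, hp⟩ := exists_word_length_eq_wordDist hgen hsymm x y
  lift l to List S using hl
  refine ⟨l, ?_, ?_⟩
  · simpa [← hn] using hy
  · simp only [hp]; group

end WordMetricLemmas

/-! ### The weak topology of a locally finite complex -/

section LocallyFinite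

variable {V : Type*} {K : AbstractSimplicialComplex V}

namespace SimplicialRealization

theorem continuous_weight : Continuous fun (p : SimplicialRealization K) (v : V) => p.weight v := by
  refine continuous_iSup_dom.2 fun σ => continuous_coinduced_dom.2 (continuous_pi fun v => ?_)
  by_cases hv : v ∈ σ.1
  · have h : ∀ p : stdSimplex ℝ σ.1, (simplexMap σ.2 p).weight v = p.1 ⟨v, hv⟩ := fun p =>
      Finsupp.embDomain_apply_self (Function.Embedding.subtype (· ∈ σ.1))
        (Finsupp.equivFunOnFinite.symm p.1) ⟨v, hv⟩
    simp only [Function.comp_def, h]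
    exact (continuous_apply _).comp continuous_subtype_val
  · have h : ∀ p : stdSimplex ℝ σ.1, (simplexMap σ.2 p).weight v = 0 := fun p =>
      Finsupp.embDomain_of_notMem_range _ _ _ (by simpa using hv)
    simp only [Function.comp_def, h]
    exact continuous_const

theorem continuous_simplexMap {σ : Finset V} (hσ : σ ∈ K.faces) :
    Continuous (simplexMap (K := K) hσ) :=
  continuous_iSup_rng (i := (⟨σ, hσ⟩ : K.faces)) continuous_coinduced_rng

theorem exists_simplexMap_eq (p : SimplicialRealization K) :
    ∃ q, simplexMap p.support_mem q = p := by
  refine ⟨⟨fun v => p.weight v, fun v => p.nonneg v, ?_⟩, ?_⟩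
  · rw [Finset.sum_coe_sort p.weight.support fun v => p.weight v]
    exact p.sum_eq_one
  · ext v
    by_cases hv : v ∈ p.weight.support
    · exact Finsupp.embDomain_apply_self (Function.Embedding.subtype (· ∈ p.weight.support)) _
        ⟨v, hv⟩
    · refine (Finsupp.embDomain_of_notMem_range _ _ _ (by simpa using hv)).trans ?_
      exact (Finsupp.notMem_support_iff.1 hv).symm

/-- If every vertex has finitely many neighbours, the weak topology is the topology of pointwise
convergence of barycentric coordinates. -/
theorem isInducing_weight (hK : ∀ v, {w | ∃ σ ∈ K.faces, v ∈ σ ∧ w ∈ σ}.Finite) :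
    Topology.IsInducing fun (p : SimplicialRealization K) (v : V) => p.weight v := by
  classical
  refine Topology.isInducing_iff_nhds.2 fun p =>
    le_antisymm continuous_weight.continuousAt.le_comap fun N hN => ?_
  obtain ⟨U, hUN, hU, hpU⟩ := mem_nhds_iff.1 hN
  obtain ⟨v, hv⟩ := p.support_mem |> K.isRelLowerSet_faces |>.1
  -- Positive weight at `v` forces the support into the finite set `B`. In the finitely many closed
  -- simplices inside `B`, the points outside `U` have compact, hence closed, image; avoiding it is
  -- an open condition on coordinates.
  let B := (hK v).toFinset
  let A : Set (V → ℝ) := ⋃ σ ∈ {σ : K.faces | σ.1 ⊆ B},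
    (fun q v => (simplexMap σ.2 q).weight v) '' (simplexMap σ.2 ⁻¹' Uᶜ)
  have hfin : {σ : K.faces | σ.1 ⊆ B}.Finite :=
    Set.Finite.of_finite_image (f := Subtype.val)
      (B.powerset.finite_toSet.subset (by rintro _ ⟨σ, hσ, rfl⟩; simpa using hσ))
      Subtype.val_injective.injOn
  have hA : IsClosed A := hfin.isClosed_biUnion fun σ _ =>
    (((hU.isClosed_compl.preimage (continuous_simplexMap σ.2)).isCompact).image
      (continuous_weight.comp (continuous_simplexMap σ.2))).isClosed
  refine ⟨Aᶜ ∩ {w | 0 < w v}, ((hA.isOpen_compl).inter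
    (isOpen_lt continuous_const (continuous_apply v))).mem_nhds ⟨fun hp => ?_, ?_⟩, ?_⟩
  · obtain ⟨σ, -, q, hq, hqp⟩ := Set.mem_iUnion₂.1 hp
    exact hq (by rwa [show simplexMap σ.2 q = p from
      SimplicialRealization.ext (DFunLike.coe_injective hqp)])
  · exact (p.nonneg v).lt_of_ne' (Finsupp.mem_support_iff.1 hv)
  · rintro r ⟨hrA, hrv⟩
    by_contra hrN
    obtain ⟨q, hq⟩ := exists_simplexMap_eq r
    refine hrA (Set.mem_iUnion₂.2 ⟨⟨_, r.support_mem⟩, fun w hw => ?_, q, ?_, by simp only [hq]⟩)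
    · exact (hK v).mem_toFinset.2 ⟨_, r.support_mem, Finsupp.mem_support_iff.2 hrv.ne', hw⟩
    · simp only [Set.mem_preimage, hq]
      exact fun h => hrN (hUN h)

end SimplicialRealization

end LocallyFinite

/-! ### Pushing measures along a level-decreasing map -/

section Push

variable {V : Type*}

/-- The fraction of the mass at level `n` that has been moved at time `t`: it increases from `0`
to `1` while `t` runs through `[1 / (n + 1), 1 / n]`. -/
noncomputable def pushRate (n : ℕ) (t : ℝ) : ℝ := max 0 (min 1 (n * ((n + 1) * t - 1)))

theorem continuous_pushRate (n : ℕ) : Continuous (pushRate n) := by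
  unfold pushRate; fun_prop

theorem pushRate_nonneg (n : ℕ) (t : ℝ) : 0 ≤ pushRate n t := le_max_left _ _

theorem pushRate_le_one (n : ℕ) (t : ℝ) : pushRate n t ≤ 1 :=
  max_le zero_le_one (min_le_left _ _)

theorem pushRate_zero_right (n : ℕ) : pushRate n 0 = 0 :=
  max_eq_left ((min_le_right _ _).trans (by simp))

theorem pushRate_one_right {n : ℕ} (hn : 0 < n) : pushRate n 1 = 1 := by
  have : (1 : ℝ) ≤ n := by exact_mod_cast hn
  rw [pushRate, min_eq_left (by nlinarith), max_eq_right zero_le_one]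

/-- The time intervals of different levels overlap at most in endpoints, so lower levels wait until
level `n` has finished. -/
theorem pushRate_eq_zero_of_lt {m n : ℕ} (hmn : m < n) {t : ℝ} (h : pushRate n t < 1) :
    pushRate m t = 0 := by
  have hmn' : (m : ℝ) + 1 ≤ n := by exact_mod_cast hmn
  have hm : (0 : ℝ) ≤ m := m.cast_nonneg
  have h1 : n * ((n + 1) * t - 1) < 1 := by
    by_contra! h1
    exact h.ne (by rw [pushRate, min_eq_left h1, max_eq_right zero_le_one])
  refine max_eq_left ((min_le_right _ _).trans (mul_nonpos_of_nonneg_of_nonpos hm ?_))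
  by_contra! h2
  have ht : 0 < t := by
    by_contra! ht
    nlinarith
  nlinarith [mul_le_mul_of_nonneg_right hmn' ht.le]

variable (level : V → ℕ) (f : V → V) (b : V → V →₀ ℝ)

/-- The measure at time `t` that starts as `b x` at time `0` and is pushed along `f`, where the
mass over a point of level `n` moves in the time interval `[1 / (n + 1), 1 / n]`. -/
noncomputable def pushFlow (t : ℝ) (x : V) : V →₀ ℝ :=
  if _h : level (f x) < level x then
    (1 - pushRate (level x) t) • b x + pushRate (level x) t • pushFlow t (f x)
  else b x
termination_by level x

variable {level f b}

theorem pushFlow_of_level_eq_zero {x : V} (hx : level x = 0) (t : ℝ) :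
    pushFlow level f b t x = b x := by
  rw [pushFlow, dif_neg (by omega)]

theorem pushFlow_of_pushRate_eq_zero {x : V} {t : ℝ} (h : pushRate (level x) t = 0) :
    pushFlow level f b t x = b x := by
  rw [pushFlow]; split_ifs <;> simp [h]

theorem pushFlow_zero (x : V) : pushFlow level f b 0 x = b x :=
  pushFlow_of_pushRate_eq_zero (pushRate_zero_right _)

theorem pushFlow_of_pushRate_eq_one (hf : ∀ x, 0 < level x → level (f x) < level x) {x : V}
    (hx : 0 < level x) {t : ℝ} (h : pushRate (level x) t = 1) :
    pushFlow level f b t x = pushFlow level f b t (f x) := by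
  rw [pushFlow, dif_pos (hf x hx)]; simp [h]

theorem pushFlow_one (hf : ∀ x, 0 < level x → level (f x) < level x) {m : V →₀ ℝ}
    (hm : ∀ x, level x = 0 → b x = m) (x : V) : pushFlow level f b 1 x = m := by
  induction h : level x using Nat.strong_induction_on generalizing x with
  | _ n ih =>
    rcases (level x).eq_zero_or_pos with h0 | h0
    · rw [pushFlow_of_level_eq_zero h0, hm x h0]
    · rw [pushFlow_of_pushRate_eq_one hf h0 (pushRate_one_right h0)]
      exact ih _ (h ▸ hf x h0) _ rfl

theorem continuous_pushFlow_apply (x v : V) :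
    Continuous fun t => pushFlow level f b t x v := by
  induction h : level x using Nat.strong_induction_on generalizing x with
  | _ n ih =>
    by_cases h' : level (f x) < level x
    · simp_rw [pushFlow.eq_1 level f b _ x, dif_pos h']
      simp only [Finsupp.add_apply, Finsupp.smul_apply, smul_eq_mul]
      have := continuous_pushRate (level x)
      exact ((continuous_const.sub this).mul continuous_const).add
        (this.mul (ih _ (h ▸ h') _ rfl))
    · simp_rw [pushFlow.eq_1 level f b _ x, dif_neg h']
      exact continuous_const

theorem pushFlow_mem {M : Set (V →₀ ℝ)} (hM : Convex ℝ M) (hb : ∀ x, b x ∈ M) (t : ℝ) (x : V) :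
    pushFlow level f b t x ∈ M := by
  induction h : level x using Nat.strong_induction_on generalizing x with
  | _ n ih =>
    rw [pushFlow]
    split_ifs with h'
    · exact hM (hb x) (ih _ (h ▸ h') _ rfl) (sub_nonneg.2 (pushRate_le_one _ _))
        (pushRate_nonneg _ _) (by ring)
    · exact hb x

/-- While `x` is still losing mass, `f x` has a lower level and is at rest, so the mass has made at
most one step. -/
theorem mem_support_pushFlow {x p : V} {t : ℝ} (ht : pushRate (level x) t < 1)
    (hp : p ∈ (pushFlow level f b t x).support) :
    p ∈ (b x).support ∨ 0 < level x ∧ p ∈ (b (f x)).support := by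
  classical
  rw [pushFlow] at hp
  split_ifs at hp with h
  · rw [pushFlow_of_pushRate_eq_zero (pushRate_eq_zero_of_lt h ht)] at hp
    rcases Finset.mem_union.1 (Finsupp.support_add hp) with hp | hp
    · exact Or.inl (Finsupp.support_smul hp)
    · exact Or.inr ⟨by omega, Finsupp.support_smul hp⟩
  · exact Or.inl hp

/-- If `f x` is adjacent to all neighbours of `x` whose level is at most that of `x`, then the
push along `f` preserves adjacency. -/
theorem exists_adj_of_mem_support_pushFlow {r : V → V → Prop} (hr : ∀ ⦃x y⦄, r x y → r y x)
    (hf : ∀ x, 0 < level x → level (f x) < level x)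
    (hdom : ∀ x y, r x y → level y ≤ level x → 0 < level x → r (f x) y) (t : ℝ) {x y : V}
    (hxy : r x y) {p q : V} (hp : p ∈ (pushFlow level f b t x).support)
    (hq : q ∈ (pushFlow level f b t y).support) :
    ∃ x' y', r x' y' ∧ p ∈ (b x').support ∧ q ∈ (b y').support := by
  induction h : level x + level y using Nat.strong_induction_on generalizing x y p q with
  | _ n ih =>
    wlog hle : level y ≤ level x generalizing x y p q
    · obtain ⟨x', y', h1, h2, h3⟩ := this (hr hxy) hq hp (by omega) (by omega)
      exact ⟨y', x', hr h1, h3, h2⟩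
    -- If level `level x` has not finished, mass from `x` has made at most one step, and mass from
    -- `y` can have moved only if the levels agree. If it has finished, `x` may be replaced by `f
    -- x`, and induction applies.
    rcases (pushRate_le_one (level x) t).lt_or_eq with h1 | h1
    · have key : q ∈ (b y).support ∨ (level y = level x ∧ 0 < level x) ∧ q ∈ (b (f y)).support := by
        rcases hle.lt_or_eq with hlt | heq
        · rw [pushFlow_of_pushRate_eq_zero (pushRate_eq_zero_of_lt hlt h1)] at hq
          exact Or.inl hq
        · exact (mem_support_pushFlow (heq ▸ h1) hq).imp_right fun h => ⟨⟨heq, heq ▸ h.1⟩, h.2⟩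
      rcases mem_support_pushFlow h1 hp with hp | ⟨h0, hp⟩ <;>
        rcases key with hq | ⟨⟨heq, h0'⟩, hq⟩
      · exact ⟨x, y, hxy, hp, hq⟩
      · exact ⟨x, f y, hr (hdom y x (hr hxy) heq.ge (heq ▸ h0')), hp, hq⟩
      · exact ⟨f x, y, hdom x y hxy hle h0, hp, hq⟩
      · refine ⟨f x, f y, hr (hdom y (f x) (hr (hdom x y hxy hle h0)) ?_ (heq ▸ h0)), hp, hq⟩
        exact heq ▸ (hf x h0).le
    · have h0 : 0 < level x := by
        rcases (level x).eq_zero_or_pos with h0 | h0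
        · simp [h0, pushRate] at h1
        · exact h0
      rw [pushFlow_of_pushRate_eq_one hf h0 h1] at hp
      exact ih _ (by have := hf x h0; omega) (hdom x y hxy hle h0) hp hq rfl

end Push

/-! ### Averaging over orbits of the finite subgroup -/

section Average

variable {G : Type*} [Group G] (H : Subgroup G)

/-- The `H`-invariant finitely supported probability measures on `G`. -/
def invariantProbability : Set (G →₀ ℝ) :=
  {m | (∀ v, 0 ≤ m v) ∧ Finsupp.linearCombination ℝ (fun _ : G => (1 : ℝ)) m = 1 ∧
    ∀ h ∈ H, ∀ v, m (h * v) = m v}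

theorem convex_invariantProbability : Convex ℝ (invariantProbability H) := by
  rintro m ⟨h1, h2, h3⟩ m' ⟨h1', h2', h3'⟩ a c ha hc hac
  refine ⟨fun v => ?_, ?_, fun h hh v => ?_⟩
  · exact add_nonneg (mul_nonneg ha (h1 v)) (mul_nonneg hc (h1' v))
  · simp [h2, h2', hac]
  · simp [h3 h hh, h3' h hh]

/-- The uniform probability measure on the orbit `H x`. -/
noncomputable def orbitAverage [Fintype H] (x : G) : G →₀ ℝ :=
  ∑ h : H, Finsupp.single (h * x : G) (Fintype.card H : ℝ)⁻¹

variable [Fintype H]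

theorem orbitAverage_mul_left {h : G} (hh : h ∈ H) (x : G) :
    orbitAverage H (h * x) = orbitAverage H x := by
  simp only [orbitAverage, ← mul_assoc]
  exact Fintype.sum_equiv (Equiv.mulRight ⟨h, hh⟩) _ _ fun _ => rfl

theorem orbitAverage_mem (x : G) : orbitAverage H x ∈ invariantProbability H := by
  classical
  refine ⟨fun v => ?_, ?_, fun h hh v => ?_⟩
  · rw [orbitAverage, Finsupp.finsetSum_apply]
    refine Finset.sum_nonneg fun h _ => ?_
    rw [Finsupp.single_apply]
    split_ifs <;> positivity
  · simp [orbitAverage]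
  · simp only [orbitAverage, Finsupp.finsetSum_apply]
    refine Fintype.sum_equiv (Equiv.mulLeft ⟨h, hh⟩⁻¹) _ _ fun k => ?_
    simp only [Finsupp.single_apply, Equiv.coe_mulLeft, Subgroup.coe_mul, Subgroup.coe_inv]
    congr 1
    rw [mul_assoc, inv_mul_eq_iff_eq_mul]

theorem exists_of_mem_support_orbitAverage {x p : G} (hp : p ∈ (orbitAverage H x).support) :
    ∃ h ∈ H, p = h * x := by
  classical
  obtain ⟨h, -, hh⟩ := Finset.mem_biUnion.1 (Finsupp.support_finsetSum hp)
  exact ⟨h, h.2, by simpa using Finsupp.support_single_subset hh⟩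

/-- Exchanging the sums gives the mean of the left translates of `m` by `H`, each equal to `m`. -/
theorem linearCombination_orbitAverage {m : G →₀ ℝ} (hm : ∀ h ∈ H, ∀ v, m (h * v) = m v) :
    Finsupp.linearCombination ℝ (orbitAverage H) m = m := by
  have key : ∀ h : H, m.mapDomain (fun x => (h : G) * x) = m := fun h => by
    ext v
    have := Finsupp.mapDomain_apply (mul_right_injective (h : G)) m ((h : G)⁻¹ * v)
    simp only [mul_inv_cancel_left] at this
    rw [this, hm _ (H.inv_mem h.2)]
  calc Finsupp.linearCombination ℝ (orbitAverage H) m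
      = ∑ h : H, (Fintype.card H : ℝ)⁻¹ • m.mapDomain (fun x => (h : G) * x) := by
        simp only [Finsupp.linearCombination_apply, orbitAverage, Finsupp.mapDomain, Finsupp.sum,
          Finset.smul_sum, Finsupp.smul_single, smul_eq_mul]
        rw [Finset.sum_comm]
        simp only [mul_comm]
    _ = m := by
        simp only [key, Finset.sum_const, Finset.card_univ]
        rw [← Nat.cast_smul_eq_nsmul ℝ, smul_smul, mul_inv_cancel₀ (by simp), one_smul]

end Average

/-! ### A quasi-centre and the push towards it -/

section QuasiCentre

variable {G : Type*} [Group G] {S : Set G} {δ : ℝ}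

/-- A finite subgroup has an orbit of diameter at most `4 δ + 1`. -/
theorem exists_orbit_wordDist_le (hgen : Subgroup.closure S = ⊤) (hsymm : S⁻¹ = S)
    (hδ : IsHyperbolicGroup S δ) (H : Subgroup G) [Fintype H] :
    ∃ x : G, ∀ h ∈ H, (wordDist S x (h * x) : ℝ) ≤ 4 * δ + 1 := by
  -- `ρ x` is the radius of the smallest ball about `x` containing `H`. A minimiser serves as the
  -- centre; `ρ` does not increase along its orbit.
  let ρ : G → ℕ := fun x => Finset.univ.sup fun h : H => wordDist S x h
  have hρle : ∀ x, ∀ h : H, wordDist S x h ≤ ρ x := fun x h =>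
    Finset.le_sup (f := fun h : H => wordDist S x h) (Finset.mem_univ h)
  obtain ⟨x, hx⟩ : ∃ x, ∀ y, ρ x ≤ ρ y :=
    ⟨Function.argmin ρ, fun y => Function.argmin_le ρ y⟩
  refine ⟨x, fun h hh => ?_⟩
  have hρh : ρ (h * x) ≤ ρ x := Finset.sup_le fun k _ => by
    have := hρle x (⟨h, hh⟩⁻¹ * k)
    rw [← wordDist_mul_left S h] at this
    simpa using this
  obtain ⟨m, hm1, hm2⟩ := exists_wordDist_eq hgen hsymm
    (Nat.div_le_self (wordDist S x (h * x)) 2)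
  obtain ⟨k, -, hk⟩ := Finset.exists_mem_eq_sup (Finset.univ : Finset H) Finset.univ_nonempty
    fun h : H => wordDist S m h
  -- The midpoint `m` also has radius at least `ρ x`, attained at `k`. With `D` the distance from
  -- `x` to `h * x`, this yields `ρ x + D ≤ ρ x + (D + 1) / 2 + 2 * δ`, so `D ≤ 4 * δ + 1`.
  have h4 := hδ.2 k m x (h * x)
  beta_reduce at h4
  have e1 := hρle x k
  have e2 := hρle (h * x) k
  have e3 : ρ x ≤ wordDist S m k := (hx m).trans hk.le
  rw [wordDist_comm hgen hsymm k m, wordDist_comm hgen hsymm k x,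
    wordDist_comm hgen hsymm k (h * x), wordDist_comm hgen hsymm m x] at h4
  set D := wordDist S x (h * x)
  have e4 : 2 * wordDist S m (h * x) ≤ D + 1 := by omega
  have e5 : 2 * wordDist S x m ≤ D := by omega
  have e2' := e2.trans hρh
  rify at e1 e2' e3 e4 e5
  rcases le_total ((wordDist S x k : ℝ) + wordDist S m (h * x))
    ((wordDist S (h * x) k : ℝ) + wordDist S x m) with h' | h'
  · rw [max_eq_right h'] at h4; linarith
  · rw [max_eq_left h'] at h4; linarith

variable (S) in
/-- The orbits of `x` and `y` under `H` have union of diameter at most `d`. -/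
def OrbitAdj (H : Subgroup G) (d : ℕ) (x y : G) : Prop :=
  ∀ h ∈ H, wordDist S x (h * x) ≤ d ∧ wordDist S y (h * y) ≤ d ∧ wordDist S x (h * y) ≤ d

theorem wordDist_mul_right_comm (hgen : Subgroup.closure S = ⊤) (hsymm : S⁻¹ = S) (h x y : G) :
    wordDist S x (h * y) = wordDist S y (h⁻¹ * x) := by
  rw [wordDist_comm hgen hsymm, ← wordDist_mul_left S h⁻¹, inv_mul_cancel_left]

theorem OrbitAdj.symm (hgen : Subgroup.closure S = ⊤) (hsymm : S⁻¹ = S) (H : Subgroup G)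
    (d : ℕ) ⦃x y : G⦄ (hxy : OrbitAdj S H d x y) : OrbitAdj S H d y x := fun h hh =>
  ⟨(hxy h hh).2.1, (hxy h hh).1, by
    rw [wordDist_mul_right_comm hgen hsymm]; exact (hxy _ (H.inv_mem hh)).2.2⟩

/-- The orbits can be moved step by step to a fixed orbit such that in each step the new orbit is
adjacent to all neighbours of the old one that have not been further away. -/
theorem exists_level_push (hgen : Subgroup.closure S = ⊤) (hsymm : S⁻¹ = S)
    (hδ : IsHyperbolicGroup S δ) {d : ℕ} (hd : 8 * δ + 3 ≤ (d : ℝ)) (H : Subgroup G)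
    [Fintype H] :
    ∃ (x₀ : G) (level : G → ℕ) (f : G → G), OrbitAdj S H d x₀ x₀ ∧
      (∀ x, level x = 0 → ∃ h ∈ H, x = h * x₀) ∧
      (∀ x, 0 < level x → level (f x) < level x) ∧
      ∀ x y, OrbitAdj S H d x y → level y ≤ level x → 0 < level x → OrbitAdj S H d (f x) y := by
  obtain ⟨x₀, hx₀⟩ := exists_orbit_wordDist_le hgen hsymm hδ H
  have hδ0 := hδ.1
  let level : G → ℕ := fun x => ⨅ h : H, wordDist S x (h * x₀)
  have hle : ∀ x, ∀ h ∈ H, level x ≤ wordDist S x (h * x₀) := fun x h hh =>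
    ciInf_le (f := fun h : H => wordDist S x (h * x₀)) (OrderBot.bddBelow _) ⟨h, hh⟩
  have hex : ∀ x, ∃ h ∈ H, wordDist S x (h * x₀) = level x := fun x => by
    obtain ⟨h, hh⟩ := exists_eq_ciInf_of_finite (f := fun h : H => wordDist S x (h * x₀))
    exact ⟨h, h.2, hh⟩
  have hinv : ∀ x, ∀ h ∈ H, level (h * x) ≤ level x := fun x h hh => by
    obtain ⟨k, hk, hkx⟩ := hex x
    rw [← hkx, ← wordDist_mul_left S h, ← mul_assoc]
    exact hle _ _ (H.mul_mem hh hk)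
  have hup : ∀ x, ∀ h ∈ H, (wordDist S x (h * x₀) : ℝ) ≤ level x + (4 * δ + 1) := fun x h hh => by
    obtain ⟨k, hk, hkx⟩ := hex x
    have h1 := wordDist_triangle hgen hsymm x (k * x₀) (h * x₀)
    have h2 := hx₀ _ (H.mul_mem (H.inv_mem hk) hh)
    rw [← wordDist_mul_left S k, mul_assoc, mul_inv_cancel_left] at h2
    rw [hkx] at h1
    rify at h1
    linarith
  choose c hcH hc using hex
  -- The step length must be positive and at least `2 * δ`, to absorb the hyperbolicity error; the
  -- upper bound gives `k + 6 * δ + 1 ≤ 8 * δ + 3 ≤ d`.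
  obtain ⟨k, hk1, hk2⟩ : ∃ k : ℕ, 2 * δ + 1 ≤ k ∧ (k : ℝ) ≤ 2 * δ + 2 :=
    ⟨⌈2 * δ⌉₊ + 1, by push_cast; linarith [Nat.le_ceil (2 * δ)],
      by push_cast; linarith [Nat.ceil_lt_add_one (show 0 ≤ 2 * δ by linarith)]⟩
  have hz : ∀ x, ∃ z, wordDist S x z = min k (level x) ∧
      min k (level x) + wordDist S z (c x * x₀) = level x := fun x => by
    have := exists_wordDist_eq hgen hsymm (x := x) (y := c x * x₀) (k := min k (level x))
      ((min_le_right _ _).trans (hc x).ge)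
    rwa [hc x] at this
  choose f hf1 hf2 using hz
  have hk0 : 0 < k := by
    have : (0 : ℝ) < k := by linarith
    exact_mod_cast this
  have hlt : ∀ x, 0 < level x → level (f x) < level x := fun x hx => by
    have := hle (f x) _ (hcH x)
    have := hf2 x
    have : 0 < min k (level x) := lt_min hk0 hx
    omega
  have dom : ∀ x y, wordDist S x y ≤ d → level y ≤ level x → wordDist S (f x) y ≤ d := by
    intro x y hxy hl
    have e1 := hup y _ (hcH x)
    have e2 := hf2 x
    rcases le_total (level x) k with h | h
    · rw [min_eq_right h] at e2
      have e3 : f x = c x * x₀ := eq_of_wordDist_eq_zero hgen hsymm (by omega)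
      rw [e3, wordDist_comm hgen hsymm]
      have : (level y : ℝ) ≤ k := by exact_mod_cast hl.trans h
      have : (wordDist S y (c x * x₀) : ℝ) ≤ d := by linarith
      exact_mod_cast this
    · rw [min_eq_left h] at e2
      have e3 := hf1 x
      rw [min_eq_left h] at e3
      -- One term of the maximum bounds the distance by `k + 6 * δ + 1`, using `hup` and `level y ≤
      -- level x`; the other bounds it by `d - k + 2 * δ`.
      have h4 := hδ.2 (f x) y x (c x * x₀)
      have e4 := hc x
      beta_reduce at h4
      rw [e4, wordDist_comm hgen hsymm (f x) x, e3, wordDist_comm hgen hsymm y x] at h4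
      rify at hxy hl e2
      have : (wordDist S (f x) y : ℝ) ≤ d := by
        rcases le_total ((k : ℝ) + wordDist S y (c x * x₀))
          ((wordDist S (f x) (c x * x₀) : ℝ) + wordDist S x y) with h' | h'
        · rw [max_eq_right h'] at h4; linarith
        · rw [max_eq_left h'] at h4; linarith
      exact_mod_cast this
  refine ⟨x₀, level, f, fun h hh => ?_, fun x hx => ?_, hlt, fun x y hxy hl hx h hh => ?_⟩
  · have : (wordDist S x₀ (h * x₀) : ℝ) ≤ d := (hx₀ h hh).trans (by linarith)
    have : wordDist S x₀ (h * x₀) ≤ d := by exact_mod_cast this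
    exact ⟨this, this, this⟩
  · exact ⟨c x, hcH x, eq_of_wordDist_eq_zero hgen hsymm ((hc x).trans hx)⟩
  · have h1 : ∀ h ∈ H, wordDist S x (h * f x) ≤ d := fun h hh => by
      rw [wordDist_mul_right_comm hgen hsymm]
      exact dom _ _ (hxy _ (H.inv_mem hh)).1 (hinv _ _ (H.inv_mem hh))
    exact ⟨dom _ _ (h1 h hh) ((hinv _ _ hh).trans (hlt x hx).le), (hxy h hh).2.1,
      dom _ _ (hxy h hh).2.2 ((hinv _ _ hh).trans hl)⟩

end QuasiCentre

/-! ### Fixed points as invariant measures -/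

section FixedPoints

variable {G : Type*} [Group G] {S : Set G} {d : ℕ} {H : Subgroup G}

theorem weight_mul_of_mem_fixedPoints {p : SimplicialRealization (ripsComplex S d)}
    (hp : p ∈ MulAction.fixedPoints H (SimplicialRealization (ripsComplex S d)))
    {h : G} (hh : h ∈ H) (v : G) : p.weight (h * v) = p.weight v := by
  have h1 : p.weight.mapDomain (h * ·) = p.weight :=
    congrArg SimplicialRealization.weight (hp ⟨h, hh⟩)
  have h2 := Finsupp.mapDomain_apply (mul_right_injective h) p.weight v
  rwa [h1] at h2

theorem mem_fixedPoints_of_weight_mul {p : SimplicialRealization (ripsComplex S d)}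
    (hp : ∀ h ∈ H, ∀ v, p.weight (h * v) = p.weight v) :
    p ∈ MulAction.fixedPoints H (SimplicialRealization (ripsComplex S d)) := by
  intro h
  apply SimplicialRealization.ext
  change p.weight.mapDomain ((h : G) * ·) = p.weight
  ext v
  have := Finsupp.mapDomain_apply (mul_right_injective (h : G)) p.weight ((h : G)⁻¹ * v)
  simp only [mul_inv_cancel_left] at this
  rw [this, hp _ (H.inv_mem h.2)]

theorem weight_mem_invariantProbability
    (p : MulAction.fixedPoints H (SimplicialRealization (ripsComplex S d))) :
    p.1.weight ∈ invariantProbability H :=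
  ⟨p.1.nonneg, by simpa [Finsupp.linearCombination_apply] using p.1.sum_eq_one,
    fun _ hh v => weight_mul_of_mem_fixedPoints p.2 hh v⟩

theorem orbitAdj_of_mem_support
    (p : MulAction.fixedPoints H (SimplicialRealization (ripsComplex S d))) {x y : G}
    (hx : x ∈ p.1.weight.support) (hy : y ∈ p.1.weight.support) : OrbitAdj S H d x y := by
  intro h hh
  have key : ∀ z ∈ p.1.weight.support, h * z ∈ p.1.weight.support := fun z hz => by
    rwa [Finsupp.mem_support_iff, weight_mul_of_mem_fixedPoints p.2 hh, ← Finsupp.mem_support_iff]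
  have hd := p.1.support_mem.2
  exact ⟨hd _ hx _ (key _ hx), hd _ hy _ (key _ hy), hd _ hx _ (key _ hy)⟩

/-- The fixed point of `H` in the Rips complex given by an `H`-invariant probability measure. -/
def fixedPointOfMeasure (m : G →₀ ℝ) (hm : m ∈ invariantProbability H)
    (hd : ∀ x ∈ m.support, ∀ y ∈ m.support, wordDist S x y ≤ d) :
    MulAction.fixedPoints H (SimplicialRealization (ripsComplex S d)) :=
  ⟨{ weight := m
     nonneg := hm.1
     sum_eq_one := by simpa [Finsupp.linearCombination_apply] using hm.2.1
     support_mem := ⟨by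
       rw [Finsupp.support_nonempty_iff]
       rintro rfl
       simpa using hm.2.1, hd⟩ }, mem_fixedPoints_of_weight_mul hm.2.2⟩

theorem wordDist_le_of_orbitAdj [Fintype H] {x y p q : G} (hxy : OrbitAdj S H d x y)
    (hp : p ∈ (orbitAverage H x).support) (hq : q ∈ (orbitAverage H y).support) :
    wordDist S p q ≤ d := by
  obtain ⟨h, hh, rfl⟩ := exists_of_mem_support_orbitAverage H hp
  obtain ⟨k, hk, rfl⟩ := exists_of_mem_support_orbitAverage H hq
  rw [← wordDist_mul_left S h⁻¹, inv_mul_cancel_left, ← mul_assoc]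
  exact (hxy _ (H.mul_mem (H.inv_mem hh) hk)).2.2

theorem linearCombination_mem_of_convex {V E : Type*} [AddCommGroup E] [Module ℝ E] {M : Set E}
    (hM : Convex ℝ M) {w : V →₀ ℝ} (h0 : ∀ v, 0 ≤ w v)
    (h1 : Finsupp.linearCombination ℝ (fun _ : V => (1 : ℝ)) w = 1) {T : V → E}
    (hT : ∀ v, T v ∈ M) : Finsupp.linearCombination ℝ T w ∈ M := by
  rw [Finsupp.linearCombination_apply]
  exact hM.sum_mem (fun v _ => h0 v)
    (by simpa [Finsupp.linearCombination_apply, Finsupp.sum] using h1) fun v _ => hT v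

theorem exists_mem_support_of_linearCombination {V W : Type*} {w : V →₀ ℝ} {T : V → W →₀ ℝ}
    {p : W} (hp : p ∈ (Finsupp.linearCombination ℝ T w).support) :
    ∃ x ∈ w.support, p ∈ (T x).support := by
  classical
  rw [Finsupp.linearCombination_apply] at hp
  obtain ⟨x, hx, hxp⟩ := Finset.mem_biUnion.1 (Finsupp.support_sum hp)
  exact ⟨x, hx, Finsupp.support_smul hxp⟩

theorem finite_ripsComplex_star (hfin : S.Finite) (hgen : Subgroup.closure S = ⊤)
    (hsymm : S⁻¹ = S) (v : G) :
    {w | ∃ σ ∈ (ripsComplex S d).faces, v ∈ σ ∧ w ∈ σ}.Finite :=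
  (finite_setOf_wordDist_le hfin hgen hsymm v d).subset fun _ ⟨_, hσ, hv, hw⟩ => hσ.2 _ hv _ hw

/-- Where the weight at one vertex `v` stays positive, all supports lie among the finitely many
neighbours of `v`, so the sum is locally a fixed finite one. Hence continuity in `t` for each vertex
separately suffices. -/
theorem continuous_linearCombination_apply {V W : Type*} {K : AbstractSimplicialComplex V}
    (hK : ∀ v, {w | ∃ σ ∈ K.faces, v ∈ σ ∧ w ∈ σ}.Finite) {T : ℝ → V → W →₀ ℝ} {g : W}
    (hT : ∀ x, Continuous fun t => T t x g) :
    Continuous fun a : ℝ × SimplicialRealization K =>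
      Finsupp.linearCombination ℝ (T a.1) a.2.weight g := by
  have hw : ∀ v, Continuous fun a : ℝ × SimplicialRealization K => a.2.weight v := fun v =>
    ((continuous_apply v).comp SimplicialRealization.continuous_weight).comp continuous_snd
  refine continuous_iff_continuousAt.2 fun a => ?_
  obtain ⟨v, hv⟩ := (K.isRelLowerSet_faces a.2.support_mem).1
  have hpos : 0 < a.2.weight v := (a.2.nonneg v).lt_of_ne' (Finsupp.mem_support_iff.1 hv)
  have hcont : Continuous fun a : ℝ × SimplicialRealization K =>
      ∑ x ∈ (hK v).toFinset, a.2.weight x * T a.1 x g :=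
    continuous_finsetSum _ fun x _ => (hw x).mul ((hT x).comp continuous_fst)
  refine hcont.continuousAt.congr ?_
  filter_upwards [(isOpen_lt continuous_const (hw v)).mem_nhds hpos] with c hc
  have hsub : c.2.weight.support ⊆ (hK v).toFinset := fun x hx =>
    (hK v).mem_toFinset.2 ⟨_, c.2.support_mem, Finsupp.mem_support_iff.2 (ne_of_gt hc), hx⟩
  rw [Finsupp.linearCombination_apply,
    Finsupp.sum_of_support_subset c.2.weight hsub (fun x r => r • T c.1 x) fun _ _ => zero_smul _ _,
    Finsupp.finsetSum_apply]
  rfl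

end FixedPoints

/-! ### The contraction of the fixed point set -/

theorem mainTheorem2 {G : Type*} [Group G] (S : Set G) (hfin : S.Finite)
    (hgen : Subgroup.closure S = ⊤) (hone : (1 : G) ∉ S) (hsymm : S⁻¹ = S)
    (δ : ℝ) (hδ : IsHyperbolicGroup S δ) (d : ℕ) (hd : 32 * δ + 20 ≤ (d : ℝ))
    (H : Subgroup G) (hH : Finite H) :
    ContractibleSpace
      (MulAction.fixedPoints H (SimplicialRealization (ripsComplex S d))) := by
  have := Fintype.ofFinite H
  have hδ0 := hδ.1
  obtain ⟨x₀, level, f, hx₀, hlevel, hf, hdom⟩ :=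
    exists_level_push hgen hsymm hδ (d := d) (by linarith) H
  have hK := finite_ripsComplex_star (d := d) hfin hgen hsymm
  have hadj := OrbitAdj.symm hgen hsymm H d
  let T := pushFlow level f (orbitAverage H)
  have hT : ∀ t x, T t x ∈ invariantProbability H :=
    pushFlow_mem (convex_invariantProbability H) (orbitAverage_mem H)
  let F : unitInterval × MulAction.fixedPoints H (SimplicialRealization (ripsComplex S d)) →
      MulAction.fixedPoints H (SimplicialRealization (ripsComplex S d)) := fun a =>
    fixedPointOfMeasure (Finsupp.linearCombination ℝ (T a.1) a.2.1.weight)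
      (linearCombination_mem_of_convex (convex_invariantProbability H) a.2.1.nonneg
        (weight_mem_invariantProbability a.2).2.1 (hT a.1)) (by
        intro p hp q hq
        obtain ⟨x, hx, hxp⟩ := exists_mem_support_of_linearCombination hp
        obtain ⟨y, hy, hyq⟩ := exists_mem_support_of_linearCombination hq
        obtain ⟨x', y', hxy, hp', hq'⟩ := exists_adj_of_mem_support_pushFlow hadj hf hdom _
          (orbitAdj_of_mem_support a.2 hx hy) hxp hyq
        exact wordDist_le_of_orbitAdj hxy hp' hq')
  have hF : Continuous F := by
    refine ((SimplicialRealization.isInducing_weight hK).comp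
      Topology.IsInducing.subtypeVal).continuous_iff.2 (continuous_pi fun g => ?_)
    have hTg : ∀ x, Continuous fun t => T t x g := fun x => continuous_pushFlow_apply x g
    have hproj : Continuous fun a : unitInterval ×
        MulAction.fixedPoints H (SimplicialRealization (ripsComplex S d)) =>
        ((a.1 : ℝ), a.2.1) :=
      (continuous_subtype_val.comp continuous_fst).prodMk
        (continuous_subtype_val.comp continuous_snd)
    have hcomp := (continuous_linearCombination_apply hK hTg).comp hproj
    refine hcomp.congr fun a => ?_
    rfl
  rw [contractible_iff_id_nullhomotopic]
  refine ⟨fixedPointOfMeasure (orbitAverage H x₀) (orbitAverage_mem H x₀)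
    (fun p hp q hq => wordDist_le_of_orbitAdj hx₀ hp hq),
    ⟨{ toFun := F, continuous_toFun := hF, map_zero_left := fun p => ?_,
       map_one_left := fun p => ?_ }⟩⟩
  · refine Subtype.ext (SimplicialRealization.ext ?_)
    change Finsupp.linearCombination ℝ (T 0) p.1.weight = p.1.weight
    rw [show T 0 = orbitAverage H from funext pushFlow_zero]
    exact linearCombination_orbitAverage H (weight_mem_invariantProbability p).2.2
  · refine Subtype.ext (SimplicialRealization.ext ?_)
    change Finsupp.linearCombination ℝ (T 1) p.1.weight = orbitAverage H x₀
    have h1 : ∀ x, T 1 x = orbitAverage H x₀ := pushFlow_one hf fun x hx => by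
      obtain ⟨h, hh, rfl⟩ := hlevel x hx
      exact orbitAverage_mul_left H hh x₀
    -- At time 1 all vertices carry the same measure, and a singleton is convex.
    simpa using linearCombination_mem_of_convex (convex_singleton (orbitAverage H x₀)) p.1.nonneg
      (weight_mem_invariantProbability p).2.1 h1
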